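/- Let $R$ be an associative ring with identity; "$R$-module" means left unital $R$-module. A short exact sequence $0\to A\to B\to C\to 0$ of $R$-modules is called pure exact (respectively, coneat exact) if it remains exact when tensored over $R$ with every right $R$-module (respectively, every simple right $R$-module). A submodule $K\subseteq N$ is called pure (respectively, coneat) in $N$ if $0\to K\to N\to N/K\to 0$ is pure exact (respectively, coneat exact). An $R$-module $M$ is called - pure injective (coneat injective) if it is injective with respect to all pure (coneat) exact sequences, i.e. for each such sequence every homomorphism $A\to M$ extends to a homomorphism $B\to M$; - quasi pure injective (quasi coneat injective) if every homomorphism $K\to M$ from a pure (coneat) submodule $K$ of $M$ extends to an endomorphism of $M$; - pure quasi injective (coneat quasi injective) if $M$ is fully invariant in its pure injective (coneat injective) envelope $E$, i.e. every endomorphism of $E$ maps $M$ into $M$. Here an envelope of $M$ with respect to a class $\mathcal F$ of modules is a homomorphism $\varphi:M\to E$ with $E\in\mathcal F$ such that every homomorphism from $M$ to a module in $\mathcal F$ factors through $\varphi$, and every endomorphism $f$ of $E$ with $f\varphi=\varphi$ is an automorphism; for the two classes above, envelopes exist and are unique up to isomorphism, $\varphi$ is injective, and $M$ is identified with $\varphi(M)$.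 The following six conditions on $R$ are equivalent: 1. Every coneat exact sequence of $R$-modules is pure exact. 2. All pure injective $R$-modules are coneat injective. 3. All pure injective $R$-modules are quasi coneat injective. 4. All pure injective $R$-modules are coneat quasi injective. 5. All quasi pure injective $R$-modules are quasi coneat injective. 6. All pure quasi injective $R$-modules are coneat quasi injective. -/

import Mathlib

open scoped TensorProduct

universe u

/-! Left modules over a ring `R` are `Module R A`; right modules are `Module Rᵐᵒᵖ G`,
where `g r` is written `MulOpposite.op r • g`. -/

namespace Coneat

section Tensor

variable (R : Type u) [Ring R] (G : Type u) [AddCommGroup G] [Module Rᵐᵒᵖ G]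

/-- The subgroup of `G ⊗[ℤ] A` generated by the elements `g r ⊗ a - g ⊗ r a`. -/
def balancedRel (A : Type u) [AddCommGroup A] [Module R A] : AddSubgroup (G ⊗[ℤ] A) :=
  AddSubgroup.closure
    {x | ∃ (g : G) (r : R) (a : A), x = (MulOpposite.op r • g) ⊗ₜ[ℤ] a - g ⊗ₜ[ℤ] (r • a)}

/-- The tensor product over `R` of the right module `G` and the left module `A`
(an abelian group); `R` need not be commutative. -/
abbrev BalancedTensor (A : Type u) [AddCommGroup A] [Module R A] : Type u :=
  (G ⊗[ℤ] A) ⧸ balancedRel R G A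

variable {R}

/-- The additive map `g ⊗ a ↦ g ⊗ f a` between the tensor products over `ℤ`. -/
def intTensorMap {A B : Type u} [AddCommGroup A] [Module R A] [AddCommGroup B] [Module R B]
    (f : A →ₗ[R] B) : (G ⊗[ℤ] A) →+ (G ⊗[ℤ] B) :=
  (LinearMap.lTensor G f.toAddMonoidHom.toIntLinearMap).toAddMonoidHom

theorem balancedRel_le_comap {A B : Type u} [AddCommGroup A] [Module R A]
    [AddCommGroup B] [Module R B] (f : A →ₗ[R] B) :
    balancedRel R G A ≤ (balancedRel R G B).comap (intTensorMap G f) := by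
  refine (AddSubgroup.closure_le _).2 ?_
  rintro _ ⟨g, r, a, rfl⟩
  refine AddSubgroup.subset_closure ⟨g, r, f a, ?_⟩
  simp [intTensorMap]

/-- The map `G ⊗ f : G ⊗_R A → G ⊗_R B` induced by an `R`-linear map `f : A → B`. -/
def tensorMap {A B : Type u} [AddCommGroup A] [Module R A] [AddCommGroup B] [Module R B]
    (f : A →ₗ[R] B) : BalancedTensor R G A →+ BalancedTensor R G B :=
  QuotientAddGroup.map _ _ (intTensorMap G f) (balancedRel_le_comap G f)

end Tensor

/-- Exactness of `0 → A → B → C → 0` for maps `i : A → B` and `p : B → C` (applied only to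
additive maps of abelian groups). -/
def IsShortExact {A B C : Type*} [Zero C] (i : A → B) (p : B → C) : Prop :=
  Function.Injective i ∧ Function.Exact i p ∧ Function.Surjective p

section

variable {R : Type u} [Ring R]

/-- The sequence `0 → A → B → C → 0` is exact and remains exact when tensored with any right
`R`-module. -/
def IsPureExact {A B C : Type u} [AddCommGroup A] [Module R A] [AddCommGroup B] [Module R B]
    [AddCommGroup C] [Module R C] (i : A →ₗ[R] B) (p : B →ₗ[R] C) : Prop :=
  IsShortExact i p ∧
    ∀ (G : Type u) [AddCommGroup G] [Module Rᵐᵒᵖ G],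
      IsShortExact (tensorMap G i) (tensorMap G p)

/-- The sequence `0 → A → B → C → 0` is exact and remains exact when tensored with any simple
right `R`-module. -/
def IsConeatExact {A B C : Type u} [AddCommGroup A] [Module R A] [AddCommGroup B] [Module R B]
    [AddCommGroup C] [Module R C] (i : A →ₗ[R] B) (p : B →ₗ[R] C) : Prop :=
  IsShortExact i p ∧
    ∀ (G : Type u) [AddCommGroup G] [Module Rᵐᵒᵖ G], IsSimpleModule Rᵐᵒᵖ G →
      IsShortExact (tensorMap G i) (tensorMap G p)

/-- `K` is a pure submodule of `N`. -/
def IsPureSubmodule {N : Type u} [AddCommGroup N] [Module R N] (K : Submodule R N) : Prop :=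
  IsPureExact K.subtype K.mkQ

/-- `K` is a coneat submodule of `N`. -/
def IsConeatSubmodule {N : Type u} [AddCommGroup N] [Module R N] (K : Submodule R N) : Prop :=
  IsConeatExact K.subtype K.mkQ

/-- `M` is injective with respect to the map `i : A → B`: every linear map `A → M` extends
along `i` to `B`. -/
def InjectiveWrt (M : Type u) [AddCommGroup M] [Module R M] {A B : Type u} [AddCommGroup A]
    [Module R A] [AddCommGroup B] [Module R B] (i : A →ₗ[R] B) : Prop :=
  ∀ f : A →ₗ[R] M, ∃ g : B →ₗ[R] M, g ∘ₗ i = f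

end

section

variable (R : Type u) [Ring R]

/-- `M` is injective with respect to all pure exact sequences. -/
def PureInjective (M : Type u) [AddCommGroup M] [Module R M] : Prop :=
  ∀ (A B C : Type u) [AddCommGroup A] [Module R A] [AddCommGroup B] [Module R B]
    [AddCommGroup C] [Module R C] (i : A →ₗ[R] B) (p : B →ₗ[R] C),
    IsPureExact i p → InjectiveWrt M i

/-- `M` is injective with respect to all coneat exact sequences. -/
def ConeatInjective (M : Type u) [AddCommGroup M] [Module R M] : Prop :=
  ∀ (A B C : Type u) [AddCommGroup A] [Module R A] [AddCommGroup B] [Module R B]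
    [AddCommGroup C] [Module R C] (i : A →ₗ[R] B) (p : B →ₗ[R] C),
    IsConeatExact i p → InjectiveWrt M i

/-- `M` is quasi pure injective: every linear map from a pure submodule of `M` to `M` extends
to `M`. -/
def QuasiPureInjective (M : Type u) [AddCommGroup M] [Module R M] : Prop :=
  ∀ K : Submodule R M, IsPureSubmodule K → InjectiveWrt M K.subtype

/-- `M` is `N`-coneat injective: every linear map from a coneat submodule of `N` to `M` extends
to `N`. -/
def RelConeatInjective (N M : Type u) [AddCommGroup N] [Module R N]
    [AddCommGroup M] [Module R M] : Prop :=
  ∀ K : Submodule R N, IsConeatSubmodule K → InjectiveWrt M K.subtype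

/-- `M` is quasi coneat injective, i.e. `M`-coneat injective. -/
def QuasiConeatInjective (M : Type u) [AddCommGroup M] [Module R M] : Prop :=
  RelConeatInjective R M M

end

section

variable {R : Type u} [Ring R]

/-- `φ : M → E` is an envelope of `M` for the class `F` of left `R`-modules: `E` is in `F`, every
map from `M` to a module in `F` factors through `φ`, and every endomorphism `f` of `E` with
`f ∘ φ = φ` is an automorphism. -/
structure IsEnvelope (F : ∀ (E : Type u) [AddCommGroup E] [Module R E], Prop)
    {M E : Type u} [AddCommGroup M] [Module R M] [AddCommGroup E] [Module R E]
    (φ : M →ₗ[R] E) : Prop where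
  mem : F E
  factors : ∀ (E' : Type u) [AddCommGroup E'] [Module R E'], F E' →
    ∀ ψ : M →ₗ[R] E', ∃ f : E →ₗ[R] E', f ∘ₗ φ = ψ
  bijective : ∀ f : E →ₗ[R] E, f ∘ₗ φ = φ → Function.Bijective f

/-- The image of `φ : M → E` is a fully invariant submodule of `E`. -/
def FullyInvariant {M E : Type u} [AddCommGroup M] [Module R M] [AddCommGroup E] [Module R E]
    (φ : M →ₗ[R] E) : Prop :=
  ∀ f : E →ₗ[R] E, (LinearMap.range φ).map f ≤ LinearMap.range φ

/-- Full invariance in an envelope does not depend on the choice of the envelope. -/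
theorem IsEnvelope.fullyInvariant_congr
    {F : ∀ (E : Type u) [AddCommGroup E] [Module R E], Prop}
    {M E E' : Type u} [AddCommGroup M] [Module R M] [AddCommGroup E] [Module R E]
    [AddCommGroup E'] [Module R E'] {φ : M →ₗ[R] E} {ψ : M →ₗ[R] E'}
    (hφ : IsEnvelope F φ) (hψ : IsEnvelope F ψ) (h : FullyInvariant φ) : FullyInvariant ψ := by
  obtain ⟨a, ha⟩ := hφ.factors E' hψ.mem ψ
  obtain ⟨b, hb⟩ := hψ.factors E hφ.mem φ
  have hab : Function.Bijective (a ∘ₗ b) :=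
    hψ.bijective _ (by rw [LinearMap.comp_assoc, hb, ha])
  have hb_inj : Function.Injective b := by
    have h1 := hab.1
    rw [LinearMap.coe_comp] at h1
    exact h1.of_comp
  rintro f _ ⟨_, ⟨m, rfl⟩, rfl⟩
  obtain ⟨n, hn⟩ := h (b ∘ₗ f ∘ₗ a) ⟨φ m, ⟨m, rfl⟩, rfl⟩
  refine ⟨n, hb_inj ?_⟩
  have h2 : a (φ m) = ψ m := LinearMap.congr_fun ha m
  have h3 : b (ψ n) = φ n := LinearMap.congr_fun hb n
  rw [h3, hn]
  simp [h2]

end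

section

variable (R : Type u) [Ring R]

/-- `M` is pure quasi injective: `M` is fully invariant in its pure injective envelope (which is
unique up to an isomorphism under `M`). -/
def PureQuasiInjective (M : Type u) [AddCommGroup M] [Module R M] : Prop :=
  ∃ (E : Type u) (_ : AddCommGroup E) (_ : Module R E) (φ : M →ₗ[R] E),
    IsEnvelope (R := R) (fun E' _ _ => PureInjective R E') φ ∧ FullyInvariant φ

/-- `M` is coneat quasi injective: `M` is fully invariant in its coneat injective envelope (which
is unique up to an isomorphism under `M`). -/
def ConeatQuasiInjective (M : Type u) [AddCommGroup M] [Module R M] : Prop :=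
  ∃ (E : Type u) (_ : AddCommGroup E) (_ : Module R E) (φ : M →ₗ[R] E),
    IsEnvelope (R := R) (fun E' _ _ => ConeatInjective R E') φ ∧ FullyInvariant φ

end

end Coneat

/-! Write `X⁺` for the group of characters of `X` with values in `ℚ/ℤ` (`AddCircle (1 : ℚ)`). Two
facts about `X⁺` carry the proof. The adjunction `Hom(A, G⁺) ≅ (G ⊗ A)⁺` shows that `G⁺` is
injective with respect to `i` exactly when `G ⊗ i` is injective (`injectiveWrt_leftCharacter_iff`).
Hence every `G⁺` is pure injective, and testing a coneat sequence against all `G⁺` gives 2 → 1.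
Evaluation `B → B⁺⁺` stays injective after any tensoring, so every module embeds purely in a pure
injective one. The main step is 3 → 2 (`coneatInjective_of_prod`). For `M` pure injective and `A →
B` coneat, `A` is a coneat submodule of the pure injective module `M × B⁺⁺`. A map `A → M` therefore
extends to an endomorphism of that product; restricting it to `B` and projecting to `M` gives the
extension wanted. Under 1 the pure and coneat notions coincide, which gives 5 and 6; each of these
returns to 3 by specializing to pure injective modules. -/

namespace Coneat

open MulOpposite

/-! ### Functoriality and right exactness of the balanced tensor product -/

section Tensor

variable {R : Type u} [Ring R] (G : Type u) [AddCommGroup G] [Module Rᵐᵒᵖ G]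
  {A B C : Type u} [AddCommGroup A] [Module R A] [AddCommGroup B] [Module R B]
  [AddCommGroup C] [Module R C]

/-- The class of the pure tensor `g ⊗ a`. -/
def balancedTmul (g : G) (a : A) : BalancedTensor R G A :=
  QuotientAddGroup.mk (g ⊗ₜ[ℤ] a)

theorem tensorMap_mk (f : A →ₗ[R] B) (x : G ⊗[ℤ] A) :
    tensorMap G f (QuotientAddGroup.mk x) = QuotientAddGroup.mk (intTensorMap G f x) := rfl

@[simp]
theorem tensorMap_balancedTmul (f : A →ₗ[R] B) (g : G) (a : A) :
    tensorMap G f (balancedTmul G g a) = balancedTmul G g (f a) := rfl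

theorem balancedTmul_smul (g : G) (r : R) (a : A) :
    balancedTmul (R := R) G (op r • g) a = balancedTmul G g (r • a) := by
  refine (QuotientAddGroup.eq_iff_sub_mem).2 ?_
  exact AddSubgroup.subset_closure ⟨g, r, a, rfl⟩

theorem balancedTmul_add_right (g : G) (a b : A) :
    balancedTmul (R := R) G g (a + b) = balancedTmul G g a + balancedTmul G g b := by
  simp only [balancedTmul, TensorProduct.tmul_add]
  rfl

theorem balancedTmul_add_left (g h : G) (a : A) :
    balancedTmul (R := R) G (g + h) a = balancedTmul G g a + balancedTmul G h a := by
  simp only [balancedTmul, TensorProduct.add_tmul]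
  rfl

variable {G} in
theorem balancedTensor_hom_ext {T : Type*} [AddCommGroup T] {χ ψ : BalancedTensor R G A →+ T}
    (h : ∀ g a, χ (balancedTmul G g a) = ψ (balancedTmul G g a)) : χ = ψ := by
  refine AddMonoidHom.ext fun x => ?_
  obtain ⟨x, rfl⟩ := QuotientAddGroup.mk_surjective x
  induction x using TensorProduct.induction_on with
  | zero => exact (map_zero χ).trans (map_zero ψ).symm
  | tmul g a => exact h g a
  | add x y hx hy =>
    rw [QuotientAddGroup.mk_add, map_add, map_add, hx, hy]

variable {G} in
/-- A balanced biadditive map induces an additive map on the balanced tensor product. -/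
def balancedLift {T : Type*} [AddCommGroup T] (β : G →+ A →+ T)
    (hβ : ∀ (g : G) (r : R) (a : A), β (op r • g) a = β g (r • a)) :
    BalancedTensor R G A →+ T :=
  QuotientAddGroup.lift (balancedRel R G A)
    (TensorProduct.liftAddHom β fun n g a => by simp)
    ((AddSubgroup.closure_le _).2 (by
      rintro _ ⟨g, r, a, rfl⟩
      simp [AddMonoidHom.mem_ker, hβ]))

theorem tensorMap_comp (f : A →ₗ[R] B) (g : B →ₗ[R] C) :
    tensorMap G (g ∘ₗ f) = (tensorMap G g).comp (tensorMap G f) :=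
  balancedTensor_hom_ext fun _ _ => rfl

theorem tensorMap_id : tensorMap G (LinearMap.id : A →ₗ[R] A) = AddMonoidHom.id _ :=
  balancedTensor_hom_ext fun _ _ => rfl

theorem tensorMap_injective_of_comp_eq_id {i : A →ₗ[R] B} {q : B →ₗ[R] A}
    (h : q ∘ₗ i = LinearMap.id) : Function.Injective (tensorMap G i) := by
  refine Function.LeftInverse.injective (g := tensorMap G q) fun x => ?_
  rw [← AddMonoidHom.comp_apply, ← tensorMap_comp, h, tensorMap_id, AddMonoidHom.id_apply]

theorem tensorMap_surjective {p : B →ₗ[R] C} (hp : Function.Surjective p) :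
    Function.Surjective (tensorMap G p) := by
  intro y
  obtain ⟨y, rfl⟩ := QuotientAddGroup.mk_surjective y
  obtain ⟨x, rfl⟩ := LinearMap.lTensor_surjective G
    (g := p.toAddMonoidHom.toIntLinearMap) hp y
  exact ⟨QuotientAddGroup.mk x, rfl⟩

/-- Each generating relation lifts along a surjection. This is what carries right exactness over `ℤ`
to the quotient by the balancing relations. -/
theorem balancedRel_le_map {p : B →ₗ[R] C} (hp : Function.Surjective p) :
    balancedRel R G C ≤ (balancedRel R G B).map (intTensorMap G p) := by
  refine (AddSubgroup.closure_le _).2 ?_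
  rintro _ ⟨g, r, c, rfl⟩
  obtain ⟨b, rfl⟩ := hp c
  refine ⟨_, AddSubgroup.subset_closure ⟨g, r, b, rfl⟩, ?_⟩
  simp [intTensorMap]

theorem tensorMap_exact {i : A →ₗ[R] B} {p : B →ₗ[R] C} (hip : Function.Exact i p)
    (hp : Function.Surjective p) : Function.Exact (tensorMap G i) (tensorMap G p) := by
  intro y
  constructor
  · obtain ⟨y, rfl⟩ := QuotientAddGroup.mk_surjective y
    intro hy
    rw [tensorMap_mk, QuotientAddGroup.eq_zero_iff] at hy
    obtain ⟨z, hz, hzy⟩ := balancedRel_le_map G hp hy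
    have hexact := lTensor_exact G (f := i.toAddMonoidHom.toIntLinearMap)
      (g := p.toAddMonoidHom.toIntLinearMap) hip hp
    -- The image of `y` vanishes only modulo relations; subtracting the lifted relation `z` makes it
    -- vanish in `G ⊗[ℤ] C`.
    have hker : intTensorMap G p (y - z) = 0 := by rw [map_sub, hzy, sub_self]
    obtain ⟨x, hx⟩ := (hexact (y - z)).1 hker
    refine ⟨QuotientAddGroup.mk x, ?_⟩
    have hx' : intTensorMap G i x = y - z := hx
    rw [tensorMap_mk, hx']
    refine QuotientAddGroup.eq_iff_sub_mem.2 ?_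
    rw [sub_sub_cancel_left]
    exact neg_mem hz
  · rintro ⟨x, rfl⟩
    rw [← AddMonoidHom.comp_apply, ← tensorMap_comp]
    refine DFunLike.congr_fun (balancedTensor_hom_ext (ψ := 0) fun g a => ?_) x
    rw [tensorMap_balancedTmul, LinearMap.comp_apply, hip.apply_apply_eq_zero,
      AddMonoidHom.zero_apply]
    simp [balancedTmul]

/-- Tensoring preserves exactness of a short exact sequence as soon as it preserves injectivity. -/
theorem IsShortExact.tensorMap_of_injective {i : A →ₗ[R] B} {p : B →ₗ[R] C}
    (h : IsShortExact i p) (hi : Function.Injective (tensorMap G i)) :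
    IsShortExact (tensorMap G i) (tensorMap G p) :=
  ⟨hi, tensorMap_exact G h.2.1 h.2.2, tensorMap_surjective G h.2.2⟩

end Tensor

/-! ### Character modules -/

section Character

/-- Characters of an abelian group separate points. -/
theorem injective_of_character_extension {X Y : Type*} [AddCommGroup X] [AddCommGroup Y]
    (f : X →+ Y) (h : ∀ χ : X →+ AddCircle (1 : ℚ), ∃ ψ : Y →+ AddCircle (1 : ℚ),
      ψ.comp f = χ) : Function.Injective f := by
  refine (injective_iff_map_eq_zero f).2 fun x hx =>
    CharacterModule.eq_zero_of_character_apply fun c => ?_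
  obtain ⟨ψ, hψ⟩ := h c
  have hx' : ψ (f x) = c x := DFunLike.congr_fun hψ x
  rw [← hx', hx, map_zero]

theorem exists_character_extension {X Y : Type*} [AddCommGroup X] [AddCommGroup Y]
    (f : X →+ Y) (hf : Function.Injective f) (χ : X →+ AddCircle (1 : ℚ)) :
    ∃ ψ : Y →+ AddCircle (1 : ℚ), ψ.comp f = χ :=
  CharacterModule.dual_surjective_of_injective f.toIntLinearMap hf χ

/-- The character group of a right module, as a left module. -/
def LeftCharacter (G : Type u) [AddCommGroup G] : Type u := G →+ AddCircle (1 : ℚ)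

/-- The character group of a left module, as a right module. -/
def RightCharacter (A : Type u) [AddCommGroup A] : Type u := A →+ AddCircle (1 : ℚ)

instance (G : Type u) [AddCommGroup G] : AddCommGroup (LeftCharacter G) :=
  inferInstanceAs (AddCommGroup (G →+ AddCircle (1 : ℚ)))

instance (A : Type u) [AddCommGroup A] : AddCommGroup (RightCharacter A) :=
  inferInstanceAs (AddCommGroup (A →+ AddCircle (1 : ℚ)))

variable {R : Type u} [Ring R]

instance (G : Type u) [AddCommGroup G] [Module Rᵐᵒᵖ G] : Module R (LeftCharacter G) where
  smul r χ := AddMonoidHom.comp χ (DistribSMul.toAddMonoidHom G (op r))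
  one_smul χ := AddMonoidHom.ext fun g => congrArg χ.toFun (one_smul Rᵐᵒᵖ g)
  mul_smul r s χ := AddMonoidHom.ext fun g =>
    congrArg χ.toFun (mul_smul (op s) (op r) g)
  smul_zero _ := rfl
  smul_add _ _ _ := rfl
  add_smul r s χ := AddMonoidHom.ext fun g =>
    (congrArg χ.toFun (add_smul (op r) (op s) g)).trans (AddMonoidHom.map_add χ _ _)
  zero_smul χ := AddMonoidHom.ext fun g =>
    (congrArg χ.toFun (zero_smul Rᵐᵒᵖ g)).trans (AddMonoidHom.map_zero χ)

instance (A : Type u) [AddCommGroup A] [Module R A] : Module Rᵐᵒᵖ (RightCharacter A) where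
  smul r χ := AddMonoidHom.comp χ (DistribSMul.toAddMonoidHom A (unop r))
  one_smul χ := AddMonoidHom.ext fun a => congrArg χ.toFun (one_smul R a)
  mul_smul r s χ := AddMonoidHom.ext fun a =>
    congrArg χ.toFun (mul_smul (unop s) (unop r) a)
  smul_zero _ := rfl
  smul_add _ _ _ := rfl
  add_smul r s χ := AddMonoidHom.ext fun a =>
    (congrArg χ.toFun (add_smul (unop r) (unop s) a)).trans (AddMonoidHom.map_add χ _ _)
  zero_smul χ := AddMonoidHom.ext fun a =>
    (congrArg χ.toFun (zero_smul R a)).trans (AddMonoidHom.map_zero χ)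

section Adjunction

variable (G : Type u) [AddCommGroup G] [Module Rᵐᵒᵖ G]
  {A B : Type u} [AddCommGroup A] [Module R A] [AddCommGroup B] [Module R B]

/-- The character of `G ⊗_R A` corresponding to a linear map `A → LeftCharacter G`. -/
def leftUncurry (f : A →ₗ[R] LeftCharacter G) : BalancedTensor R G A →+ AddCircle (1 : ℚ) :=
  balancedLift (AddMonoidHom.flip (f.toAddMonoidHom : A →+ G →+ AddCircle (1 : ℚ)))
    fun g r a => (DFunLike.congr_fun (F := G →+ AddCircle (1 : ℚ)) (f.map_smul r a) g).symm

/-- The linear map `A → LeftCharacter G` corresponding to a character of `G ⊗_R A`. -/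
def leftCurry (χ : BalancedTensor R G A →+ AddCircle (1 : ℚ)) : A →ₗ[R] LeftCharacter G where
  toFun a := (AddMonoidHom.mk' (fun g => χ (balancedTmul G g a)) fun g h => by
    rw [balancedTmul_add_left, map_add] : G →+ AddCircle (1 : ℚ))
  map_add' a b := AddMonoidHom.ext fun g =>
    (congrArg χ (balancedTmul_add_right G g a b)).trans (map_add χ _ _)
  map_smul' r a := AddMonoidHom.ext fun g => congrArg χ (balancedTmul_smul G g r a).symm

/-- The right linear map `G → RightCharacter A` corresponding to a character of `G ⊗_R A`. -/
def rightCurry (χ : BalancedTensor R G A →+ AddCircle (1 : ℚ)) :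
    G →ₗ[Rᵐᵒᵖ] RightCharacter A where
  toFun g := (AddMonoidHom.mk' (fun a => χ (balancedTmul G g a)) fun a b => by
    rw [balancedTmul_add_right, map_add] : A →+ AddCircle (1 : ℚ))
  map_add' g h := AddMonoidHom.ext fun a =>
    (congrArg χ (balancedTmul_add_left G g h a)).trans (map_add χ _ _)
  map_smul' r g := AddMonoidHom.ext fun a => congrArg χ (balancedTmul_smul G g (unop r) a)

/-- By currying, extending maps into the character module along `i` is extending characters along `G
⊗ i`. All characters extend exactly when that map is injective: characters separate points, and
`ℚ/ℤ` is injective. -/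
theorem injectiveWrt_leftCharacter_iff (i : A →ₗ[R] B) :
    InjectiveWrt (LeftCharacter G) i ↔ Function.Injective (tensorMap G i) := by
  constructor
  · intro h
    refine injective_of_character_extension _ fun χ => ?_
    obtain ⟨f, hf⟩ := h (leftCurry G χ)
    refine ⟨leftUncurry G f, balancedTensor_hom_ext fun g a => ?_⟩
    exact DFunLike.congr_fun (F := G →+ AddCircle (1 : ℚ)) (LinearMap.congr_fun hf a) g
  · intro h f
    obtain ⟨ψ, hψ⟩ := exists_character_extension _ h (leftUncurry G f)
    refine ⟨leftCurry G ψ, LinearMap.ext fun a => AddMonoidHom.ext fun g => ?_⟩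
    exact DFunLike.congr_fun hψ (balancedTmul G g a)

theorem pureInjective_leftCharacter : PureInjective R (LeftCharacter G) :=
  fun _ _ _ _ _ _ _ _ _ i _ h => (injectiveWrt_leftCharacter_iff G i).2 (h.2 G).1

variable (R A) in
/-- The evaluation map from a left module to its double character module. -/
def evalDoubleCharacter : A →ₗ[R] LeftCharacter (RightCharacter A) where
  toFun a := (AddMonoidHom.eval a : (A →+ AddCircle (1 : ℚ)) →+ AddCircle (1 : ℚ))
  map_add' a b := AddMonoidHom.ext fun χ => AddMonoidHom.map_add χ a b
  map_smul' _ _ := rfl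

/-- A character `χ` of `G ⊗ A` is a right linear map `G → A⁺`; composing it with `ξ ∈ A⁺⁺` defines
an extension of `χ` to `G ⊗ A⁺⁺`. -/
theorem tensorMap_evalDoubleCharacter_injective :
    Function.Injective (tensorMap G (evalDoubleCharacter R A)) := by
  refine injective_of_character_extension _ fun χ => ?_
  refine ⟨balancedLift (AddMonoidHom.flip (AddMonoidHom.mk'
    (fun ξ : LeftCharacter (RightCharacter A) =>
    AddMonoidHom.comp ξ (rightCurry G χ).toAddMonoidHom) fun _ _ => rfl)) fun g r ξ => ?_,
    balancedTensor_hom_ext fun g a => rfl⟩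
  exact congrArg ξ.toFun ((rightCurry G χ).map_smul (op r) g)

theorem evalDoubleCharacter_injective : Function.Injective (evalDoubleCharacter R A) := by
  refine injective_of_character_extension (evalDoubleCharacter R A).toAddMonoidHom fun χ => ?_
  exact ⟨(AddMonoidHom.eval (χ : RightCharacter A) :
    (RightCharacter A →+ AddCircle (1 : ℚ)) →+ AddCircle (1 : ℚ)), rfl⟩

end Adjunction

end Character

/-! ### Pure and coneat injectivity -/

section Injectivity

variable {R : Type u} [Ring R] {A B C M N E : Type u} [AddCommGroup A] [Module R A]
  [AddCommGroup B] [Module R B] [AddCommGroup C] [Module R C] [AddCommGroup M] [Module R M]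
  [AddCommGroup N] [Module R N] [AddCommGroup E] [Module R E]

theorem IsPureExact.isConeatExact {i : A →ₗ[R] B} {p : B →ₗ[R] C} (h : IsPureExact i p) :
    IsConeatExact i p :=
  ⟨h.1, fun G _ _ _ => h.2 G⟩

theorem ConeatInjective.pureInjective (h : ConeatInjective R M) : PureInjective R M :=
  fun A B C _ _ _ _ _ _ i p hip => h A B C i p hip.isConeatExact

theorem PureInjective.quasiPureInjective (h : PureInjective R M) : QuasiPureInjective R M :=
  fun K hK => h K M (M ⧸ K) K.subtype K.mkQ hK

theorem ConeatInjective.quasiConeatInjective (h : ConeatInjective R M) :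
    QuasiConeatInjective R M :=
  fun K hK => h K M (M ⧸ K) K.subtype K.mkQ hK

theorem PureInjective.prod (hM : PureInjective R M) (hN : PureInjective R N) :
    PureInjective R (M × N) := by
  intro A B C _ _ _ _ _ _ i p hip f
  obtain ⟨g, hg⟩ := hM A B C i p hip (LinearMap.fst R M N ∘ₗ f)
  obtain ⟨h, hh⟩ := hN A B C i p hip (LinearMap.snd R M N ∘ₗ f)
  refine ⟨g.prod h, LinearMap.ext fun a => Prod.ext ?_ ?_⟩
  · exact LinearMap.congr_fun hg a
  · exact LinearMap.congr_fun hh a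

theorem isEnvelope_id {F : ∀ (E : Type u) [AddCommGroup E] [Module R E], Prop} (h : F M) :
    IsEnvelope F (LinearMap.id : M →ₗ[R] M) where
  mem := h
  factors _ _ _ _ ψ := ⟨ψ, rfl⟩
  bijective f hf := by
    rw [LinearMap.comp_id] at hf
    exact hf ▸ Function.bijective_id

theorem fullyInvariant_id : FullyInvariant (LinearMap.id : M →ₗ[R] M) := fun f => by
  rw [LinearMap.range_id]
  exact le_top

theorem PureInjective.pureQuasiInjective (h : PureInjective R M) : PureQuasiInjective R M :=
  ⟨M, _, _, LinearMap.id, isEnvelope_id h, fullyInvariant_id⟩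

theorem ConeatInjective.coneatQuasiInjective (h : ConeatInjective R M) :
    ConeatQuasiInjective R M :=
  ⟨M, _, _, LinearMap.id, isEnvelope_id h, fullyInvariant_id⟩

/-- After tensoring, `j` is a surjection followed by the map induced by the inclusion of its range,
so injectivity of the composite passes to the latter. -/
theorem isConeatSubmodule_range {j : A →ₗ[R] B} (hj : ∀ (G : Type u) [AddCommGroup G]
    [Module Rᵐᵒᵖ G], IsSimpleModule Rᵐᵒᵖ G → Function.Injective (tensorMap G j)) :
    IsConeatSubmodule (LinearMap.range j) := by
  have hexact : IsShortExact (LinearMap.range j).subtype (LinearMap.range j).mkQ :=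
    ⟨Submodule.subtype_injective _, LinearMap.exact_subtype_mkQ _, Submodule.mkQ_surjective _⟩
  refine ⟨hexact, fun G _ _ hG => hexact.tensorMap_of_injective G ?_⟩
  have hcomp := hj G hG
  rw [← LinearMap.subtype_comp_codRestrict j _ (LinearMap.mem_range_self j), tensorMap_comp,
    AddMonoidHom.coe_comp] at hcomp
  exact hcomp.of_comp_right (tensorMap_surjective G j.surjective_rangeRestrict)

/-- A module is coneat injective if its products with pure injective modules are quasi coneat
injective. -/
theorem coneatInjective_of_prod (h : ∀ (N : Type u) [AddCommGroup N] [Module R N],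
    PureInjective R N → QuasiConeatInjective R (M × N)) : ConeatInjective R M := by
  intro A B C _ _ _ _ _ _ i p hip f
  let N := LeftCharacter (RightCharacter B)
  let e : B →ₗ[R] M × N := LinearMap.inr R M N ∘ₗ evalDoubleCharacter R B
  let j : A →ₗ[R] M × N := e ∘ₗ i
  have he : Function.Injective e :=
    LinearMap.inr_injective.comp evalDoubleCharacter_injective
  have hj : Function.Injective j := he.comp hip.1.1
  have hK : IsConeatSubmodule (LinearMap.range j) := by
    refine isConeatSubmodule_range fun G _ _ hG => ?_
    rw [tensorMap_comp, tensorMap_comp]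
    -- The three factors stay injective for different reasons: `inr` is split, evaluation is pure,
    -- and `i` is coneat.
    exact ((tensorMap_injective_of_comp_eq_id G (LinearMap.snd_comp_inr _ _ _)).comp
      (tensorMap_evalDoubleCharacter_injective G)).comp (hip.2 G hG).1
  obtain ⟨g, hg⟩ := h N (pureInjective_leftCharacter _) _ hK
    -- `A` sits in the factor `N`, while `f` is sent into the factor `M`.
    (LinearMap.inl R M N ∘ₗ f ∘ₗ (LinearEquiv.ofInjective j hj).symm.toLinearMap)
  refine ⟨LinearMap.fst R M N ∘ₗ g ∘ₗ e, LinearMap.ext fun a => ?_⟩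
  have ha := LinearMap.congr_fun hg (LinearEquiv.ofInjective j hj a)
  simp only [LinearMap.comp_apply, LinearEquiv.coe_coe, LinearEquiv.symm_apply_apply,
    Submodule.subtype_apply, LinearEquiv.ofInjective_apply] at ha
  exact congrArg Prod.fst ha

/-- Every module embeds into a coneat injective module. -/
theorem exists_injective_to_coneatInjective (R : Type u) [Ring R] (M : Type u) [AddCommGroup M]
    [Module R M] : ∃ (I : Type u) (_ : AddCommGroup I) (_ : Module R I) (f : M →ₗ[R] I),
      ConeatInjective R I ∧ Function.Injective f := by
  -- An injective module is in particular coneat injective.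
  obtain ⟨⟨J, hJ, f, hf⟩⟩ := (inferInstance :
    CategoryTheory.EnoughInjectives (ModuleCat.{u} R)).presentation (ModuleCat.of R M)
  refine ⟨J, inferInstance, inferInstance, f.hom, ?_, (ModuleCat.mono_iff_injective f).1 hf⟩
  have hinj : Module.Injective R J := Module.injective_module_of_injective_object R J
  intro A B C _ _ _ _ _ _ i p hip g
  obtain ⟨k, hk⟩ := hinj.out i hip.1.1 g
  exact ⟨k, LinearMap.ext hk⟩

theorem IsEnvelope.injective_of_coneatInjective {φ : M →ₗ[R] E}
    (h : IsEnvelope (R := R) (fun E' _ _ => ConeatInjective R E') φ) : Function.Injective φ := by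
  obtain ⟨I, _, _, f, hI, hf⟩ := exists_injective_to_coneatInjective R M
  obtain ⟨k, hk⟩ := h.factors I hI f
  rw [← hk, LinearMap.coe_comp] at hf
  exact hf.of_comp

/-- A map `K → M` extends to `M → E`, then to an endomorphism of the envelope `E`; full invariance
brings its restriction to `M` back into `M`. -/
theorem ConeatQuasiInjective.quasiConeatInjective (h : ConeatQuasiInjective R M) :
    QuasiConeatInjective R M := by
  obtain ⟨E, _, _, φ, hφ, hinv⟩ := h
  intro K hK f
  have hφi := hφ.injective_of_coneatInjective
  obtain ⟨g, hg⟩ := hφ.mem K M (M ⧸ K) K.subtype K.mkQ hK (φ ∘ₗ f)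
  obtain ⟨k, hk⟩ := hφ.factors E hφ.mem g
  have hrange : ∀ m, (k ∘ₗ φ) m ∈ LinearMap.range φ := fun m =>
    hinv k (Submodule.mem_map_of_mem (LinearMap.mem_range_self φ m))
  refine ⟨(LinearEquiv.ofInjective φ hφi).symm.toLinearMap ∘ₗ (k ∘ₗ φ).codRestrict _ hrange,
    LinearMap.ext fun x => (LinearEquiv.ofInjective φ hφi).injective (Subtype.ext ?_)⟩
  simp only [LinearMap.comp_apply, LinearEquiv.coe_coe, LinearEquiv.apply_symm_apply,
    LinearMap.codRestrict_apply, LinearEquiv.ofInjective_apply]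
  exact (LinearMap.congr_fun hk x).trans (LinearMap.congr_fun hg x)

theorem IsConeatExact.isPureExact
    (h : ∀ (M : Type u) [AddCommGroup M] [Module R M], PureInjective R M → ConeatInjective R M)
    {i : A →ₗ[R] B} {p : B →ₗ[R] C} (hip : IsConeatExact i p) : IsPureExact i p :=
  ⟨hip.1, fun G _ _ => hip.1.tensorMap_of_injective G ((injectiveWrt_leftCharacter_iff G i).1
    (h _ (pureInjective_leftCharacter G) A B C i p hip))⟩

end Injectivity

end Coneat

theorem mainTheorem6 (R : Type u) [Ring R] :
    List.TFAE [
      ∀ (A B C : Type u) [AddCommGroup A] [Module R A] [AddCommGroup B] [Module R B]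
        [AddCommGroup C] [Module R C] (i : A →ₗ[R] B) (p : B →ₗ[R] C),
        Coneat.IsConeatExact i p → Coneat.IsPureExact i p,
      ∀ (M : Type u) [AddCommGroup M] [Module R M],
        Coneat.PureInjective R M → Coneat.ConeatInjective R M,
      ∀ (M : Type u) [AddCommGroup M] [Module R M],
        Coneat.PureInjective R M → Coneat.QuasiConeatInjective R M,
      ∀ (M : Type u) [AddCommGroup M] [Module R M],
        Coneat.PureInjective R M → Coneat.ConeatQuasiInjective R M,
      ∀ (M : Type u) [AddCommGroup M] [Module R M],
        Coneat.QuasiPureInjective R M → Coneat.QuasiConeatInjective R M,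
      ∀ (M : Type u) [AddCommGroup M] [Module R M],
        Coneat.PureQuasiInjective R M → Coneat.ConeatQuasiInjective R M] := by
  have h12 : ∀ (_ : ∀ (A B C : Type u) [AddCommGroup A] [Module R A] [AddCommGroup B] [Module R B]
      [AddCommGroup C] [Module R C] (i : A →ₗ[R] B) (p : B →ₗ[R] C),
      Coneat.IsConeatExact i p → Coneat.IsPureExact i p) (M : Type u) [AddCommGroup M] [Module R M],
      Coneat.PureInjective R M → Coneat.ConeatInjective R M :=
    fun h M _ _ hM A B C _ _ _ _ _ _ i p hip => hM A B C i p (h A B C i p hip)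
  tfae_have 1 → 2 := h12
  tfae_have 2 → 1 := fun h A B C _ _ _ _ _ _ i p hip => hip.isPureExact h
  tfae_have 2 → 3 := fun h M _ _ hM => (h M hM).quasiConeatInjective
  tfae_have 3 → 2 := fun h M _ _ hM =>
    Coneat.coneatInjective_of_prod fun N _ _ hN => h (M × N) (hM.prod hN)
  tfae_have 2 → 4 := fun h M _ _ hM => (h M hM).coneatQuasiInjective
  tfae_have 4 → 3 := fun h M _ _ hM => (h M hM).quasiConeatInjective
  tfae_have 1 → 5 := fun h M _ _ hM K hK => hM K (h K M (M ⧸ K) K.subtype K.mkQ hK)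
  tfae_have 5 → 3 := fun h M _ _ hM => h M hM.quasiPureInjective
  tfae_have 1 → 6 := by
    rintro h M _ _ ⟨E, _, _, φ, hφ, hinv⟩
    -- Under 1 the two injectivity classes agree, so the same `φ` is also a coneat injective
    -- envelope.
    exact ⟨E, _, _, φ, ⟨h12 h E hφ.mem, fun E' _ _ hE' => hφ.factors E' hE'.pureInjective,
      hφ.bijective⟩, hinv⟩
  tfae_have 6 → 4 := fun h M _ _ hM => h M hM.pureQuasiInjective
  tfae_finish
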